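/- Let $1<\alpha\le 2$, and let $(w_j)_{j\ge 0}$ be the sequence of real numbers (it exists and is unique) such that for every $n\ge 1$ \[ \begin{pmatrix} w_0 & 0 & \cdots & 0\\ w_1 & w_0 & \ddots & \vdots\\ \vdots & \ddots & \ddots & 0\\ w_{n-1} & \cdots & w_1 & w_0 \end{pmatrix} \begin{pmatrix} 1\\ 2^{\alpha-1}\\ \vdots\\ n^{\alpha-1}\end{pmatrix} = \begin{pmatrix}\Gamma(\alpha)\\ 0\\ \vdots\\ 0\end{pmatrix}. \] Then $w_1<0$, $w_j\ge 0$ for all $j\ne 1$, and $\sum_{j=0}^\infty w_j=0$, the series being convergent. If moreover $\alpha<2$, then $w_j>0$ for all $j\neq 1$. -/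

import Mathlib

open scoped Matrix

/-- The `n × n` lower triangular Toeplitz matrix with entries `w 0` on the diagonal, `w 1` on the
first subdiagonal, ..., `w (n - 1)` in the lower left corner. -/
def weightMatrix (w : ℕ → ℝ) (n : ℕ) : Matrix (Fin n) (Fin n) ℝ :=
  Matrix.of fun i k => if k ≤ i then w ((i : ℕ) - (k : ℕ)) else 0

/-- The vector `(1, 2 ^ (α - 1), ..., n ^ (α - 1))`. -/
noncomputable def powerVector (α : ℝ) (n : ℕ) : Fin n → ℝ :=
  fun k => (((k : ℕ) : ℝ) + 1) ^ (α - 1)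

/-- The vector `(Γ(α), 0, ..., 0)` of length `n`. -/
noncomputable def gammaVector (α : ℝ) (n : ℕ) : Fin n → ℝ :=
  fun i => if (i : ℕ) = 0 then Real.Gamma α else 0

/-- `w` is the sequence of weights of order `α`: it solves the lower triangular system of every
size `n`. -/
def IsWeightSequence (α : ℝ) (w : ℕ → ℝ) : Prop :=
  ∀ n : ℕ, weightMatrix w n *ᵥ powerVector α n = gammaVector α n

theorem weightMatrix_mulVec_powerVector (α : ℝ) (w : ℕ → ℝ) (n : ℕ) (i : Fin n) :
    (weightMatrix w n *ᵥ powerVector α n) i =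
      ∑ k ∈ Finset.range ((i : ℕ) + 1), w ((i : ℕ) - k) * ((k : ℝ) + 1) ^ (α - 1) := by
  have h1 : (weightMatrix w n *ᵥ powerVector α n) i =
      ∑ k : Fin n, (fun k : ℕ => if k ≤ (i : ℕ) then
        w ((i : ℕ) - k) * ((k : ℝ) + 1) ^ (α - 1) else 0) (k : ℕ) := by
    simp only [Matrix.mulVec, dotProduct, weightMatrix, powerVector, Matrix.of_apply, Fin.le_def,
      ite_mul, zero_mul]
  rw [h1, Fin.sum_univ_eq_sum_range (fun k : ℕ => if k ≤ (i : ℕ) then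
        w ((i : ℕ) - k) * ((k : ℝ) + 1) ^ (α - 1) else 0) n, ← Finset.sum_filter]
  refine Finset.sum_congr ?_ fun _ _ => rfl
  ext k
  have := i.isLt
  simp only [Finset.mem_filter, Finset.mem_range]
  omega

/-- The systems of all sizes together say that a convolution vanishes except at `0`. -/
theorem isWeightSequence_iff (α : ℝ) (w : ℕ → ℝ) :
    IsWeightSequence α w ↔ ∀ m : ℕ,
      ∑ k ∈ Finset.range (m + 1), w (m - k) * ((k : ℝ) + 1) ^ (α - 1) =
        if m = 0 then Real.Gamma α else 0 := by
  constructor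
  · intro h m
    have h2 := congrFun (h (m + 1)) (Fin.last m)
    rw [weightMatrix_mulVec_powerVector] at h2
    simpa [gammaVector] using h2
  · intro h n
    funext i
    rw [weightMatrix_mulVec_powerVector, h]
    rfl

/-- The weights exist and are uniquely determined by the systems. -/
theorem existsUnique_isWeightSequence (α : ℝ) : ∃! w : ℕ → ℝ, IsWeightSequence α w := by
  set A : PowerSeries ℝ := PowerSeries.mk fun k => ((k : ℝ) + 1) ^ (α - 1) with hA
  have hA0 : PowerSeries.constantCoeff A ≠ 0 := by
    rw [← PowerSeries.coeff_zero_eq_constantCoeff_apply, hA, PowerSeries.coeff_mk]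
    simp
  have key : ∀ w : ℕ → ℝ, IsWeightSequence α w ↔
      A * PowerSeries.mk w = PowerSeries.C (Real.Gamma α) := by
    intro w
    rw [isWeightSequence_iff, PowerSeries.ext_iff]
    refine forall_congr' fun m => ?_
    rw [PowerSeries.coeff_mul, PowerSeries.coeff_C,
      Finset.Nat.sum_antidiagonal_eq_sum_range_succ_mk]
    simp [hA, mul_comm]
  refine ⟨fun m => PowerSeries.coeff m (A⁻¹ * PowerSeries.C (Real.Gamma α)), ?_, ?_⟩
  · refine (key _).2 ?_
    have : PowerSeries.mk (fun m => PowerSeries.coeff m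
        (A⁻¹ * PowerSeries.C (Real.Gamma α))) = A⁻¹ * PowerSeries.C (Real.Gamma α) := by
      ext m; simp
    rw [this, ← mul_assoc, PowerSeries.mul_inv_cancel A hA0, one_mul]
  · intro w hw
    funext m
    have h := (key w).1 hw
    show w m = PowerSeries.coeff m (A⁻¹ * PowerSeries.C (Real.Gamma α))
    rw [← h, ← mul_assoc, PowerSeries.inv_mul_cancel A hA0, one_mul, PowerSeries.coeff_mk]

/-! Put `s = α - 1` and `b k = (k + 1) ^ s - k ^ s`. In generating functions the systems say `W * A
= Γ(α)`, and `(1 - X) * A = B` is the series of the `b k`. Writing `1 / B = 1 - X * C` gives `W =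
Γ(α) (1 - X) (1 - X * C)`, so up to the factor `Γ(α)` the weights are `1`, `-(1 + c 0)` and `c j - c
(j + 1)`. It remains to show that the renewal sequence `c` is nonnegative, decreasing (strictly if
`s < 1`) and tends to `0`.

For `s < 1`, the `b k` are moments of a probability measure on `(0, 1)`, by the Lévy integral for `x
^ s` (`levyFunctional_X_pow`). Multiplication by `X` followed by projection then expresses `c` and
its differences as integrals of nonnegative polynomials (`map_X_mul_projectedPower_mul`,
`renewalCoeff_strictAnti`). For `s = 1`, `c` is explicit. The limit comes from
`tendsto_zero_of_renewal`. -/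

open Polynomial in
/-- Monic polynomials orthogonal to `1` for the functional `L`, obtained by repeatedly multiplying
by `X` and projecting. -/
noncomputable def projectedPower (L : ℝ[X] →ₗ[ℝ] ℝ) : ℕ → ℝ[X]
  | 0 => 1
  | n + 1 => Polynomial.X * projectedPower L n
      - Polynomial.C (L (Polynomial.X * projectedPower L n))

open Polynomial in
/-- The renewal sequence of the moments of `L`. -/
noncomputable def renewalCoeff (L : ℝ[X] →ₗ[ℝ] ℝ) (n : ℕ) : ℝ := L (X * projectedPower L n)

/-! ### Renewal sequences of moment functionals -/

section Functional

open Polynomial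

variable {L : ℝ[X] →ₗ[ℝ] ℝ}

theorem projectedPower_succ (n : ℕ) :
    projectedPower L (n + 1) = X * projectedPower L n - C (renewalCoeff L n) := rfl

theorem map_mul_C (p : ℝ[X]) (a : ℝ) : L (p * C a) = a * L p := by
  rw [mul_comm, ← smul_eq_C_mul, map_smul, smul_eq_mul]

theorem projectedPower_monic (n : ℕ) :
    (projectedPower L n).Monic ∧ (projectedPower L n).natDegree = n := by
  induction n with
  | zero => simp [projectedPower]
  | succ n ih =>
    have h1 : (X * projectedPower L n).Monic := monic_X.mul ih.1
    have h2 : (X * projectedPower L n).natDegree = n + 1 := by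
      rw [monic_X.natDegree_mul ih.1, ih.2, natDegree_X, add_comm]
    have h3 : (C (renewalCoeff L n)).degree < (X * projectedPower L n).degree := by
      refine degree_C_le.trans_lt ?_
      rw [degree_eq_natDegree h1.ne_zero, h2]
      exact_mod_cast n.succ_pos
    rw [projectedPower_succ]
    exact ⟨h1.sub_of_left h3, by rw [natDegree_sub_C, h2]⟩

theorem projectedPower_ne_zero (n : ℕ) : projectedPower L n ≠ 0 :=
  (projectedPower_monic n).1.ne_zero

theorem map_projectedPower_succ (h1 : L 1 = 1) (n : ℕ) : L (projectedPower L (n + 1)) = 0 := by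
  have := map_mul_C (L := L) 1 (renewalCoeff L n)
  rw [one_mul, h1, mul_one] at this
  rw [projectedPower_succ, map_sub, this, renewalCoeff, sub_self]

/-- Shifting one step from `i` to `j` leaves the value unchanged: the two correction terms both
equal the product of the coefficients of index `i` and `j`, and cancel. -/
theorem map_X_mul_projectedPower_mul (i j : ℕ) :
    L (X * (projectedPower L i * projectedPower L j)) = renewalCoeff L (i + j) := by
  induction i generalizing j with
  | zero => simp [projectedPower, renewalCoeff]
  | succ i ih =>
    have h : X * (projectedPower L (i + 1) * projectedPower L j) =
        X * (projectedPower L i * projectedPower L (j + 1)) +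
          X * projectedPower L i * C (renewalCoeff L j) -
          X * projectedPower L j * C (renewalCoeff L i) := by
      simp only [projectedPower_succ]; ring
    rw [h, map_sub, map_add, map_mul_C, map_mul_C, ih, ← add_assoc, add_right_comm]
    simp only [renewalCoeff]
    ring

theorem map_projectedPower_succ_mul (h1 : L 1 = 1) (i j : ℕ) :
    L (projectedPower L (i + 1) * projectedPower L (j + 1)) = renewalCoeff L (i + j + 1) := by
  have h : projectedPower L (i + 1) * projectedPower L (j + 1) =
      X * (projectedPower L (i + 1) * projectedPower L j) -
        projectedPower L (i + 1) * C (renewalCoeff L j) := by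
    rw [projectedPower_succ j]; ring
  rw [h, map_sub, map_mul_C, map_projectedPower_succ h1, map_X_mul_projectedPower_mul,
    mul_zero, sub_zero, add_right_comm]

theorem X_pow_eq_projectedPower_add (n : ℕ) :
    (X : ℝ[X]) ^ n = projectedPower L n +
      ∑ j ∈ Finset.range n, X ^ (n - 1 - j) * C (renewalCoeff L j) := by
  induction n with
  | zero => simp [projectedPower]
  | succ n ih =>
    rw [pow_succ', ih, Finset.sum_range_succ, projectedPower_succ, mul_add, Finset.mul_sum]
    have : ∀ j ∈ Finset.range n, X * (X ^ (n - 1 - j) * C (renewalCoeff L j)) =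
        X ^ (n + 1 - 1 - j) * C (renewalCoeff L j) := by
      intro j hj
      have hj := Finset.mem_range.1 hj
      rw [← mul_assoc, ← pow_succ']
      congr 2
      omega
    rw [Finset.sum_congr rfl this]
    simp

/-- The renewal equation. -/
theorem map_X_pow_succ (h1 : L 1 = 1) (n : ℕ) :
    L (X ^ (n + 1)) = ∑ j ∈ Finset.range (n + 1), renewalCoeff L j * L (X ^ (n - j)) := by
  rw [X_pow_eq_projectedPower_add (L := L) (n + 1), map_add, map_projectedPower_succ h1, map_sum,
    zero_add]
  simp only [map_mul_C, Nat.add_sub_cancel]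

theorem renewalCoeff_pos (h1 : L 1 = 1)
    (hL : ∀ q : ℝ[X], q ≠ 0 → (∀ x ∈ Set.Ioo (0 : ℝ) 1, 0 ≤ q.eval x) → 0 < L q) (n : ℕ) :
    0 < renewalCoeff L n := by
  obtain ⟨k, rfl | rfl⟩ := n.even_or_odd'
  · rw [two_mul, ← map_X_mul_projectedPower_mul]
    refine hL _ (mul_ne_zero X_ne_zero
      (mul_ne_zero (projectedPower_ne_zero k) (projectedPower_ne_zero k))) fun x hx => ?_
    rw [eval_mul, eval_mul, eval_X]
    exact mul_nonneg hx.1.le (mul_self_nonneg _)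
  · rw [two_mul, ← map_projectedPower_succ_mul h1]
    refine hL _ (mul_ne_zero (projectedPower_ne_zero _) (projectedPower_ne_zero _)) fun x _ => ?_
    rw [eval_mul]
    exact mul_self_nonneg _

theorem renewalCoeff_strictAnti (h1 : L 1 = 1)
    (hL : ∀ q : ℝ[X], q ≠ 0 → (∀ x ∈ Set.Ioo (0 : ℝ) 1, 0 ≤ q.eval x) → 0 < L q) :
    StrictAnti (renewalCoeff L) := by
  have hX : (1 - X : ℝ[X]) ≠ 0 := fun h => by
    have := congrArg (eval 0) h
    simp at this
  refine strictAnti_nat_of_succ_lt fun n => ?_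
  obtain ⟨k, rfl | rfl⟩ := n.even_or_odd'
  -- With `P = projectedPower L k`, applying `L` gives `c (2k) - c (2k+1) = L (X (1 - X) P²) + (c
  -- k)²`.
  · have h : projectedPower L (k + 1) * projectedPower L (k + 1) =
        X * (projectedPower L k * projectedPower L k) -
          X * (1 - X) * (projectedPower L k * projectedPower L k) -
          X * projectedPower L k * C (renewalCoeff L k) -
          projectedPower L (k + 1) * C (renewalCoeff L k) := by
      simp only [projectedPower_succ]; ring
    have h2 := congrArg L h
    rw [map_sub, map_sub, map_sub, map_mul_C, map_mul_C, map_projectedPower_succ h1,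
      map_X_mul_projectedPower_mul, map_projectedPower_succ_mul h1] at h2
    have h3 : 0 < L (X * (1 - X) * (projectedPower L k * projectedPower L k)) := by
      refine hL _ (mul_ne_zero (mul_ne_zero X_ne_zero hX)
        (mul_ne_zero (projectedPower_ne_zero k) (projectedPower_ne_zero k))) fun x hx => ?_
      simp only [eval_mul, eval_sub, eval_X, eval_one]
      exact mul_nonneg (mul_nonneg hx.1.le (sub_nonneg.2 hx.2.le)) (mul_self_nonneg _)
    have h4 : L (X * projectedPower L k) = renewalCoeff L k := rfl
    rw [h4] at h2
    rw [two_mul]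
    linarith [mul_self_nonneg (renewalCoeff L k)]
  · have h3 : 0 < L ((1 - X) * (projectedPower L (k + 1) * projectedPower L (k + 1))) := by
      refine hL _ (mul_ne_zero hX
        (mul_ne_zero (projectedPower_ne_zero _) (projectedPower_ne_zero _))) fun x hx => ?_
      simp only [eval_mul, eval_sub, eval_X, eval_one]
      exact mul_nonneg (sub_nonneg.2 hx.2.le) (mul_self_nonneg _)
    rw [sub_mul, one_mul, map_sub, map_X_mul_projectedPower_mul,
      map_projectedPower_succ_mul h1] at h3
    have e1 : k + 1 + (k + 1) = 2 * k + 1 + 1 := by ring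
    have e2 : k + k + 1 = 2 * k + 1 := by ring
    rw [e1, e2] at h3
    linarith

end Functional

/-! ### Power increments as moments -/

section Moments

open MeasureTheory Set

/-- The Lévy density of the subordinator with exponent `s`, weighted by `1 - exp (-u)`. -/
noncomputable def levyWeight (s u : ℝ) : ℝ := (1 - Real.exp (-u)) * u ^ (-s - 1)

theorem levyWeight_pos (s : ℝ) {u : ℝ} (hu : 0 < u) : 0 < levyWeight s u :=
  mul_pos (sub_pos.2 (Real.exp_lt_one_iff.2 (neg_neg_of_pos hu))) (Real.rpow_pos_of_pos hu _)

/-- Compare with `u ^ (-s)` near `0`, which needs `s < 1`, and with `u ^ (-s - 1)` at infinity,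
which needs `0 < s`. -/
theorem integrableOn_levyWeight {s : ℝ} (h0 : 0 < s) (h1 : s < 1) :
    IntegrableOn (levyWeight s) (Ioi 0) := by
  have hm : Measurable (levyWeight s) := by unfold levyWeight; fun_prop
  rw [← Ioc_union_Ioi_eq_Ioi zero_le_one]
  refine IntegrableOn.union ?_ ?_
  · have hi : IntegrableOn (fun u : ℝ => u ^ (-s)) (Ioc 0 1) := by
      rw [← intervalIntegrable_iff_integrableOn_Ioc_of_le zero_le_one]
      exact intervalIntegral.intervalIntegrable_rpow' (by linarith)
    refine hi.mono' hm.aestronglyMeasurable ?_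
    refine (ae_restrict_iff' measurableSet_Ioc).2 (ae_of_all _ fun u hu => ?_)
    rw [Real.norm_of_nonneg (levyWeight_pos s hu.1).le, levyWeight]
    have e : u ^ (-s) = u * u ^ (-s - 1) := by
      rw [Real.rpow_sub_one hu.1.ne']
      field_simp [hu.1.ne']
    rw [e]
    gcongr
    · exact Real.rpow_nonneg hu.1.le _
    · linarith [Real.add_one_le_exp (-u)]
  · have hi : IntegrableOn (fun u : ℝ => u ^ (-s - 1)) (Ioi 1) :=
      integrableOn_Ioi_rpow_of_lt (by linarith) one_pos
    refine hi.mono' hm.aestronglyMeasurable ?_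
    refine (ae_restrict_iff' measurableSet_Ioi).2 (ae_of_all _ fun u hu => ?_)
    have hu0 : (0 : ℝ) < u := one_pos.trans hu
    rw [Real.norm_of_nonneg (levyWeight_pos s hu0).le, levyWeight]
    exact mul_le_of_le_one_left (Real.rpow_nonneg hu0.le _)
      (by linarith [Real.exp_pos (-u)])

theorem integrableOn_eval_mul_levyWeight {s : ℝ} (h0 : 0 < s) (h1 : s < 1)
    (p : Polynomial ℝ) :
    IntegrableOn (fun u => p.eval (Real.exp (-u)) * levyWeight s u) (Ioi 0) := by
  obtain ⟨M, hM⟩ := (isCompact_Icc (a := (0 : ℝ)) (b := 1)).exists_bound_of_continuousOn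
    p.continuous.continuousOn
  have hc : Continuous fun u : ℝ => p.eval (Real.exp (-u)) :=
    p.continuous.comp (Real.continuous_exp.comp continuous_neg)
  refine (integrableOn_levyWeight h0 h1).bdd_mul (c := M) hc.aestronglyMeasurable ?_
  refine (ae_restrict_iff' measurableSet_Ioi).2 (ae_of_all _ fun u hu => hM _ ?_)
  exact ⟨(Real.exp_pos _).le, (Real.exp_lt_one_iff.2 (neg_neg_of_pos hu)).le⟩

/-- Integration of polynomials in `exp (-u)` against `levyWeight s`. -/
noncomputable def levyFunctional {s : ℝ} (h0 : 0 < s) (h1 : s < 1) :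
    Polynomial ℝ →ₗ[ℝ] ℝ where
  toFun p := ∫ u in Ioi 0, p.eval (Real.exp (-u)) * levyWeight s u
  map_add' p q := by
    rw [← integral_add (integrableOn_eval_mul_levyWeight h0 h1 p)
      (integrableOn_eval_mul_levyWeight h0 h1 q)]
    simp only [Polynomial.eval_add, add_mul]
  map_smul' a p := by
    rw [RingHom.id_apply, smul_eq_mul, ← integral_const_mul]
    simp only [Polynomial.eval_smul, smul_eq_mul, mul_assoc]

theorem levyFunctional_pos {s : ℝ} (h0 : 0 < s) (h1 : s < 1) (q : Polynomial ℝ) (hq : q ≠ 0)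
    (hnn : ∀ x ∈ Ioo (0 : ℝ) 1, 0 ≤ q.eval x) : 0 < levyFunctional h0 h1 q := by
  have hnn' : ∀ u ∈ Ioi (0 : ℝ), 0 ≤ q.eval (Real.exp (-u)) * levyWeight s u := fun u hu =>
    mul_nonneg (hnn _ ⟨Real.exp_pos _, Real.exp_lt_one_iff.2 (neg_neg_of_pos hu)⟩)
      (levyWeight_pos s hu).le
  change 0 < ∫ u in Ioi 0, q.eval (Real.exp (-u)) * levyWeight s u
  rw [setIntegral_pos_iff_support_of_nonneg_ae
    ((ae_restrict_iff' measurableSet_Ioi).2 (ae_of_all _ hnn'))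
    (integrableOn_eval_mul_levyWeight h0 h1 q)]
  -- A nonzero polynomial has finitely many roots, so the integrand is nonzero off a null set.
  have hfin : {u : ℝ | q.eval (Real.exp (-u)) = 0}.Finite := by
    refine Set.Finite.preimage (f := fun u : ℝ => Real.exp (-u)) (s := {x | q.eval x = 0})
      (fun a _ b _ h => neg_injective (Real.exp_injective h)) ?_
    exact Polynomial.finite_setOfPred_isRoot hq
  have hsub : Ioi (0 : ℝ) \ {u : ℝ | q.eval (Real.exp (-u)) = 0} ⊆
      Function.support (fun u => q.eval (Real.exp (-u)) * levyWeight s u) ∩ Ioi 0 :=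
    fun u hu => ⟨mul_ne_zero hu.2 (levyWeight_pos s hu.1).ne', hu.1⟩
  refine lt_of_lt_of_le ?_ (measure_mono hsub)
  rw [measure_sdiff_null (hfin.measure_zero _)]
  simp

/-- Both sides scale in the same way in `x`. -/
theorem integral_one_sub_exp_mul_rpow {s x : ℝ} (h0 : 0 < s) (hx : 0 ≤ x) :
    ∫ u in Ioi (0 : ℝ), (1 - Real.exp (-(x * u))) * u ^ (-s - 1) =
      x ^ s * ∫ u in Ioi (0 : ℝ), levyWeight s u := by
  rcases hx.eq_or_lt with rfl | hx
  · simp [Real.zero_rpow h0.ne']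
  have h := integral_comp_mul_left_Ioi (levyWeight s) 0 hx
  rw [mul_zero, smul_eq_mul] at h
  have e : ∀ u ∈ Ioi (0 : ℝ), (1 - Real.exp (-(x * u))) * u ^ (-s - 1) =
      x ^ (s + 1) * levyWeight s (x * u) := by
    intro u hu
    have hu : 0 < u := hu
    rw [levyWeight, Real.mul_rpow hx.le hu.le]
    have : x ^ (s + 1) * x ^ (-s - 1) = 1 := by
      rw [← Real.rpow_add hx]; simp
    linear_combination -((1 - Real.exp (-(x * u))) * u ^ (-s - 1)) * this
  rw [setIntegral_congr_fun measurableSet_Ioi e, integral_const_mul, h, ← mul_assoc,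
    Real.rpow_add_one hx.ne', mul_assoc (x ^ s), mul_inv_cancel₀ hx.ne', mul_one]

theorem integrableOn_one_sub_exp_mul_rpow {s : ℝ} (h0 : 0 < s) (h1 : s < 1) (k : ℕ) :
    IntegrableOn (fun u : ℝ => (1 - Real.exp (-((k : ℝ) * u))) * u ^ (-s - 1)) (Ioi 0) := by
  -- `1 - exp (-k u)` is `1 - exp (-u)` times a geometric sum in `exp (-u)`.
  convert integrableOn_eval_mul_levyWeight h0 h1
    (∑ i ∈ Finset.range k, (Polynomial.X : Polynomial ℝ) ^ i) using 2 with u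
  rw [levyWeight, ← mul_assoc]
  congr 1
  rw [Polynomial.eval_finsetSum]
  simp only [Polynomial.eval_pow, Polynomial.eval_X]
  rw [geom_sum_mul_neg, ← Real.exp_nat_mul, mul_neg]

/-- Split `exp (-k u) (1 - exp (-u))` as `(1 - exp (-(k + 1) u)) - (1 - exp (-k u))` and scale each
integral. -/
theorem levyFunctional_X_pow {s : ℝ} (h0 : 0 < s) (h1 : s < 1) (k : ℕ) :
    levyFunctional h0 h1 (Polynomial.X ^ k) =
      (((k : ℝ) + 1) ^ s - (k : ℝ) ^ s) * levyFunctional h0 h1 1 := by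
  have e1 : levyFunctional h0 h1 1 = ∫ u in Ioi (0 : ℝ), levyWeight s u := by
    simp [levyFunctional]
  have hk := integral_one_sub_exp_mul_rpow h0 (Nat.cast_nonneg (α := ℝ) k)
  have hk1 := integral_one_sub_exp_mul_rpow h0 (Nat.cast_nonneg (α := ℝ) (k + 1))
  rw [e1, sub_mul, ← hk, ← Nat.cast_succ, ← hk1, ← integral_sub
    (integrableOn_one_sub_exp_mul_rpow h0 h1 (k + 1)) (integrableOn_one_sub_exp_mul_rpow h0 h1 k)]
  refine integral_congr_ae (ae_of_all _ fun u => ?_)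
  simp only [levyWeight, Polynomial.eval_pow, Polynomial.eval_X, ← Real.exp_nat_mul]
  have : Real.exp (-(((k + 1 : ℕ) : ℝ) * u)) = Real.exp (k * -u) * Real.exp (-u) := by
    rw [← Real.exp_add]; push_cast; ring_nf
  rw [this, mul_neg]
  ring

end Moments

theorem exists_strictAnti_renewal {s : ℝ} (h0 : 0 < s) (h1 : s < 1) :
    ∃ c : ℕ → ℝ, (∀ n, 0 < c n) ∧ StrictAnti c ∧
      ∀ n : ℕ, (((n + 1 : ℕ) : ℝ) + 1) ^ s - ((n + 1 : ℕ) : ℝ) ^ s =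
        ∑ j ∈ Finset.range (n + 1),
          c j * ((((n - j : ℕ) : ℝ) + 1) ^ s - ((n - j : ℕ) : ℝ) ^ s) := by
  have hK : 0 < levyFunctional h0 h1 1 :=
    levyFunctional_pos h0 h1 1 one_ne_zero fun x _ => by simp
  set L := (levyFunctional h0 h1 1)⁻¹ • levyFunctional h0 h1 with hLdef
  have hL1 : L 1 = 1 := by simp [hLdef, hK.ne']
  have hpos : ∀ q : Polynomial ℝ, q ≠ 0 → (∀ x ∈ Set.Ioo (0 : ℝ) 1, 0 ≤ q.eval x) → 0 < L q :=
    fun q hq hnn => mul_pos (inv_pos.2 hK) (levyFunctional_pos h0 h1 q hq hnn)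
  have hmom : ∀ k : ℕ, L (Polynomial.X ^ k) = ((k : ℝ) + 1) ^ s - (k : ℝ) ^ s := by
    intro k
    rw [hLdef, LinearMap.smul_apply, levyFunctional_X_pow, smul_eq_mul]
    field_simp
  refine ⟨renewalCoeff L, renewalCoeff_pos hL1 hpos, renewalCoeff_strictAnti hL1 hpos, fun n => ?_⟩
  have := map_X_pow_succ hL1 n
  simpa only [hmom] using this

/-! ### From the renewal sequence to the weights -/

section Weights

variable {s : ℝ} {c : ℕ → ℝ}

theorem powerSeries_mul_renewal_eq_one (h0 : 0 < s)
    (hc : ∀ n : ℕ, (((n + 1 : ℕ) : ℝ) + 1) ^ s - ((n + 1 : ℕ) : ℝ) ^ s =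
        ∑ j ∈ Finset.range (n + 1),
          c j * ((((n - j : ℕ) : ℝ) + 1) ^ s - ((n - j : ℕ) : ℝ) ^ s)) :
    (1 - PowerSeries.X * PowerSeries.mk c) *
      PowerSeries.mk (fun k : ℕ => ((k : ℝ) + 1) ^ s - (k : ℝ) ^ s) = 1 := by
  ext n
  rw [sub_mul, one_mul, mul_assoc, map_sub]
  cases n with
  | zero => simp [Real.zero_rpow h0.ne']
  | succ n =>
    rw [PowerSeries.coeff_succ_X_mul, PowerSeries.coeff_mul, PowerSeries.coeff_mk, hc,
      Finset.Nat.sum_antidiagonal_eq_sum_range_succ_mk]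
    simp [PowerSeries.coeff_one]

theorem weights_eq_of_renewal (h0 : 0 < s) {w : ℕ → ℝ} (hw : IsWeightSequence (s + 1) w)
    (hc : ∀ n : ℕ, (((n + 1 : ℕ) : ℝ) + 1) ^ s - ((n + 1 : ℕ) : ℝ) ^ s =
        ∑ j ∈ Finset.range (n + 1),
          c j * ((((n - j : ℕ) : ℝ) + 1) ^ s - ((n - j : ℕ) : ℝ) ^ s)) :
    PowerSeries.mk w = PowerSeries.C (Real.Gamma (s + 1)) *
      ((1 - PowerSeries.X) * (1 - PowerSeries.X * PowerSeries.mk c)) := by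
  have hA : PowerSeries.mk (fun k : ℕ => ((k : ℝ) + 1) ^ s) * PowerSeries.mk w =
      PowerSeries.C (Real.Gamma (s + 1)) := by
    ext m
    rw [PowerSeries.coeff_mul, PowerSeries.coeff_C, ← (isWeightSequence_iff _ _).1 hw m,
      Finset.Nat.sum_antidiagonal_eq_sum_range_succ_mk]
    exact Finset.sum_congr rfl fun k _ => by simp [mul_comm]
  have hB : (1 - PowerSeries.X) * PowerSeries.mk (fun k : ℕ => ((k : ℝ) + 1) ^ s) =
      PowerSeries.mk (fun k : ℕ => ((k : ℝ) + 1) ^ s - (k : ℝ) ^ s) := by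
    ext m
    rw [sub_mul, one_mul, map_sub]
    cases m with
    | zero => simp [Real.zero_rpow h0.ne']
    | succ m => simp [PowerSeries.coeff_succ_X_mul]
  have h1 := powerSeries_mul_renewal_eq_one h0 hc
  rw [← hB] at h1
  rw [← hA]
  linear_combination -(PowerSeries.mk w) * h1

theorem weight_apply_of_renewal (h0 : 0 < s) {w : ℕ → ℝ} (hw : IsWeightSequence (s + 1) w)
    (hc : ∀ n : ℕ, (((n + 1 : ℕ) : ℝ) + 1) ^ s - ((n + 1 : ℕ) : ℝ) ^ s =
        ∑ j ∈ Finset.range (n + 1),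
          c j * ((((n - j : ℕ) : ℝ) + 1) ^ s - ((n - j : ℕ) : ℝ) ^ s)) :
    w 0 = Real.Gamma (s + 1) ∧ w 1 = -(Real.Gamma (s + 1) * (1 + c 0)) ∧
      ∀ j, w (j + 2) = Real.Gamma (s + 1) * (c j - c (j + 1)) := by
  have h := weights_eq_of_renewal h0 hw hc
  have hx : ((1 - PowerSeries.X) * (1 - PowerSeries.X * PowerSeries.mk c) : PowerSeries ℝ) =
      1 - PowerSeries.X * (1 + PowerSeries.mk c - PowerSeries.X * PowerSeries.mk c) := by ring
  rw [hx] at h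
  have hn := fun n => congrArg (PowerSeries.coeff n) h
  simp only [PowerSeries.coeff_C_mul, PowerSeries.coeff_mk, map_sub] at hn
  refine ⟨?_, ?_, fun j => ?_⟩
  · rw [hn]; simp
  · rw [hn, show (1 : ℕ) = 0 + 1 from rfl, PowerSeries.coeff_succ_X_mul]
    simp [PowerSeries.coeff_one]
    ring
  · rw [hn, PowerSeries.coeff_succ_X_mul, map_sub, PowerSeries.coeff_succ_X_mul]
    simp [PowerSeries.coeff_one]

/-- Bounding every `c j` below by `c n` in the renewal equation, the increments telescope to `(n +
1) ^ s`, while the left side is at most `1` by subadditivity of `x ^ s`. -/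
theorem tendsto_zero_of_renewal (h0 : 0 < s) (h1 : s ≤ 1) (hnn : ∀ n, 0 ≤ c n)
    (hanti : Antitone c)
    (hc : ∀ n : ℕ, (((n + 1 : ℕ) : ℝ) + 1) ^ s - ((n + 1 : ℕ) : ℝ) ^ s =
        ∑ j ∈ Finset.range (n + 1),
          c j * ((((n - j : ℕ) : ℝ) + 1) ^ s - ((n - j : ℕ) : ℝ) ^ s)) :
    Filter.Tendsto c Filter.atTop (nhds 0) := by
  have hb : ∀ k : ℕ, 0 ≤ ((k : ℝ) + 1) ^ s - (k : ℝ) ^ s := fun k =>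
    sub_nonneg.2 (Real.rpow_le_rpow k.cast_nonneg (by linarith) h0.le)
  have hle : ∀ n : ℕ, c n ≤ (((n + 1 : ℕ) : ℝ) ^ s)⁻¹ := by
    intro n
    have hpos : (0 : ℝ) < ((n + 1 : ℕ) : ℝ) ^ s := Real.rpow_pos_of_pos (by positivity) _
    rw [← one_div, le_div_iff₀ hpos]
    have hsum : ∑ j ∈ Finset.range (n + 1),
        ((((n - j : ℕ) : ℝ) + 1) ^ s - ((n - j : ℕ) : ℝ) ^ s) = ((n + 1 : ℕ) : ℝ) ^ s := by
      have h := Finset.sum_range_reflect (fun k : ℕ => ((k : ℝ) + 1) ^ s - (k : ℝ) ^ s) (n + 1)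
      have h2 := Finset.sum_range_sub (fun k : ℕ => (k : ℝ) ^ s) (n + 1)
      simp only [Nat.add_sub_cancel] at h
      rw [h]
      simpa [Real.zero_rpow h0.ne'] using h2
    calc c n * ((n + 1 : ℕ) : ℝ) ^ s
        ≤ (((n + 1 : ℕ) : ℝ) + 1) ^ s - ((n + 1 : ℕ) : ℝ) ^ s := by
          rw [hc, ← hsum, Finset.mul_sum]
          exact Finset.sum_le_sum fun j hj => mul_le_mul_of_nonneg_right
            (hanti (Nat.lt_succ_iff.1 (Finset.mem_range.1 hj))) (hb _)
      _ ≤ 1 := by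
          have := Real.rpow_add_le_add_rpow (Nat.cast_nonneg (α := ℝ) (n + 1)) zero_le_one h0.le h1
          rw [Real.one_rpow] at this
          linarith
  refine squeeze_zero hnn hle ?_
  exact ((tendsto_rpow_atTop h0).comp (tendsto_natCast_atTop_atTop.comp
    (Filter.tendsto_add_atTop_nat 1))).inv_tendsto_atTop

theorem hasSum_weights_of_renewal (h0 : 0 < s) (h1 : s ≤ 1) {w : ℕ → ℝ}
    (hw : IsWeightSequence (s + 1) w) (hnn : ∀ n, 0 ≤ c n) (hanti : Antitone c)
    (hc : ∀ n : ℕ, (((n + 1 : ℕ) : ℝ) + 1) ^ s - ((n + 1 : ℕ) : ℝ) ^ s =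
        ∑ j ∈ Finset.range (n + 1),
          c j * ((((n - j : ℕ) : ℝ) + 1) ^ s - ((n - j : ℕ) : ℝ) ^ s)) :
    HasSum w 0 := by
  obtain ⟨hw0, hw1, hw2⟩ := weight_apply_of_renewal h0 hw hc
  have hG : 0 < Real.Gamma (s + 1) := Real.Gamma_pos_of_pos (by linarith)
  have ht := tendsto_zero_of_renewal h0 h1 hnn hanti hc
  -- From index `2` on the weights are nonnegative and telescope to `Γ(s + 1) * c 0`, which cancels
  -- `w 0 + w 1`.
  rw [← hasSum_nat_add_iff' 2]
  have hsum : (0 : ℝ) - ∑ i ∈ Finset.range 2, w i = Real.Gamma (s + 1) * c 0 := by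
    rw [Finset.sum_range_succ, Finset.sum_range_one, hw0, hw1]; ring
  rw [hsum]
  simp only [hw2]
  refine HasSum.mul_left _ ((hasSum_iff_tendsto_nat_of_nonneg
    (fun j => sub_nonneg.2 (hanti j.le_succ)) _).2 ?_)
  simp only [Finset.sum_range_sub']
  simpa using ht.const_sub (c 0)

end Weights

/-- At `s = 1` the Lévy integral diverges at `0`, but every increment is `1`, so `c = (1, 0, 0,
...)`. -/
theorem renewal_one (n : ℕ) :
    (((n + 1 : ℕ) : ℝ) + 1) ^ (1 : ℝ) - ((n + 1 : ℕ) : ℝ) ^ (1 : ℝ) =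
      ∑ j ∈ Finset.range (n + 1), (if j = 0 then (1 : ℝ) else 0) *
        ((((n - j : ℕ) : ℝ) + 1) ^ (1 : ℝ) - ((n - j : ℕ) : ℝ) ^ (1 : ℝ)) := by
  simp

theorem proposition2p3 (α : ℝ) (hα₁ : 1 < α) (hα₂ : α ≤ 2) (w : ℕ → ℝ)
    (hw : IsWeightSequence α w) :
    w 1 < 0 ∧
    (∀ j : ℕ, j ≠ 1 → 0 ≤ w j) ∧
    (α < 2 → ∀ j : ℕ, j ≠ 1 → 0 < w j) ∧
    HasSum w 0 := by
  obtain ⟨s, rfl⟩ : ∃ s, α = s + 1 := ⟨α - 1, by ring⟩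
  have h0 : 0 < s := by linarith
  have h1 : s ≤ 1 := by linarith
  have hG : 0 < Real.Gamma (s + 1) := Real.Gamma_pos_of_pos (by linarith)
  obtain ⟨c, hnn, hanti, hstrict, hc⟩ : ∃ c : ℕ → ℝ, (∀ n, 0 ≤ c n) ∧ Antitone c ∧
      (s < 1 → StrictAnti c) ∧
      ∀ n : ℕ, (((n + 1 : ℕ) : ℝ) + 1) ^ s - ((n + 1 : ℕ) : ℝ) ^ s =
        ∑ j ∈ Finset.range (n + 1),
          c j * ((((n - j : ℕ) : ℝ) + 1) ^ s - ((n - j : ℕ) : ℝ) ^ s) := by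
    rcases h1.lt_or_eq with h1 | rfl
    · obtain ⟨c, hpos, hanti, hc⟩ := exists_strictAnti_renewal h0 h1
      exact ⟨c, fun n => (hpos n).le, hanti.antitone, fun _ => hanti, hc⟩
    · refine ⟨fun j => if j = 0 then 1 else 0, fun n => ?_, antitone_nat_of_succ_le fun n => ?_,
        fun h => absurd h (lt_irrefl _), renewal_one⟩
      · positivity
      · simp only [Nat.succ_ne_zero, if_false]
        positivity
  obtain ⟨hw0, hw1, hw2⟩ := weight_apply_of_renewal h0 hw hc
  refine ⟨?_, ?_, ?_, hasSum_weights_of_renewal h0 h1 hw hnn hanti hc⟩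
  · rw [hw1]
    exact neg_neg_of_pos (mul_pos hG (by linarith [hnn 0]))
  · rintro (_ | _ | j) hj
    · exact hw0 ▸ hG.le
    · exact absurd rfl hj
    · exact (hw2 j).symm ▸ mul_nonneg hG.le (sub_nonneg.2 (hanti j.le_succ))
  · rintro hs (_ | _ | j) hj
    · exact hw0 ▸ hG
    · exact absurd rfl hj
    · exact (hw2 j).symm ▸ mul_pos hG (sub_pos.2 (hstrict (by linarith) j.lt_succ_self))
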